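/- Let $\mathbb{M}_n$ be the $n\times n$ complex matrices and $\mathbb{M}_n^+$ the positive semidefinite ones. Let $\Omega\subset[0,\infty)$ be an interval, and let $\mathbb{M}_n\{\Omega\}$ denote the Hermitian matrices in $\mathbb{M}_n$ with spectrum in $\Omega$. A function $f:\Omega\to[0,\infty)$ is called doubly concave if it is continuous, concave, and geometrically concave, i.e. $f(\sqrt{xy})\ge\sqrt{f(x)f(y)}$ for all $x,y\in\Omega$; $f(A)$ is defined by functional calculus. A derived anti-norm on $\mathbb{M}_n^+$ is a functional of the form $$\|A\|_!=\|A^{-r}\|^{-1/r}\ \text{ if } A \text{ is invertible},\qquad \|A\|_!=0\ \text{ otherwise},$$ where $\|\cdot\|$ is a symmetric (that is, unitarily invariant) norm on $\mathbb{M}_n$ and $r>0$. For $p>0$ the power mean of $A,B\in\mathbb{M}_n^+$ is $A\,\beta_p\,B=\left(\frac{A^p+B^p}{2}\right)^{1/p}$, and likewise for non-negative scalars. For $p=0$, $A\,\beta_0\,B=\exp\left(\frac{\log A+\log B}{2}\right)$ for invertible $A,B\in\mathbb{M}_n^+$, and $a\,\beta_0\,b=\sqrt{ab}$ for scalars $a,b\ge0$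 (so it is $0$ if $a=0$ or $b=0$). **Proposition.** If $f$ is doubly concave on $\Omega$ and $A,B\in\mathbb{M}_n\{\Omega\}$, then $$\|f(A\,\beta_p\,B)\|_!\ \ge\ \|f(A)\|_!\,\beta_p\,\|f(B)\|_!$$ for all derived anti-norms $\|\cdot\|_!$ on $\mathbb{M}_n^+$ and all $0<p\le1$. If moreover $A,B$ are invertible, the inequality also holds for $p=0$. -/

import Mathlib

open scoped Matrix ComplexOrder

noncomputable section

/-- `f` is doubly concave on `Ω`: `Ω ⊆ [0, ∞)` is an interval on which `f` is continuous,
non-negative, concave and geometrically concave. -/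
structure DoublyConcaveOn (Ω : Set ℝ) (f : ℝ → ℝ) : Prop where
  ordConnected : Ω.OrdConnected
  subset_Ici : Ω ⊆ Set.Ici 0
  continuousOn : ContinuousOn f Ω
  nonneg : ∀ x ∈ Ω, 0 ≤ f x
  concaveOn : ConcaveOn ℝ Ω f
  geomConcave : ∀ x ∈ Ω, ∀ y ∈ Ω, Real.sqrt (f x * f y) ≤ f (Real.sqrt (x * y))

/-- `A ∈ 𝕄ₙ{Ω}`: the complex matrix `A` is Hermitian with spectrum in `Ω`. -/
def HermitianSpectrumIn {n : ℕ} (Ω : Set ℝ) (A : Matrix (Fin n) (Fin n) ℂ) : Prop :=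
  A.IsHermitian ∧ spectrum ℝ A ⊆ Ω

/-- The power `A ^ p` of a positive semidefinite matrix, by functional calculus; for a negative
exponent it is used for invertible `A` only. -/
def matrixRpow {n : ℕ} (A : Matrix (Fin n) (Fin n) ℂ) (p : ℝ) : Matrix (Fin n) (Fin n) ℂ :=
  cfc (fun t : ℝ => t ^ p) A

/-- The power mean `A β_p B = ((A ^ p + B ^ p) / 2) ^ (1 / p)` for `p ≠ 0`, with
`A β_0 B = exp ((log A + log B) / 2)`; the latter is used for invertible `A`, `B` only. -/
def matrixPowerMean {n : ℕ} (p : ℝ) (A B : Matrix (Fin n) (Fin n) ℂ) :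
    Matrix (Fin n) (Fin n) ℂ :=
  if p = 0 then
    cfc Real.exp ((1 / 2 : ℝ) • (cfc Real.log A + cfc Real.log B))
  else
    matrixRpow ((1 / 2 : ℝ) • (matrixRpow A p + matrixRpow B p)) (1 / p)

/-- The power mean of two non-negative scalars. For `a, b > 0` one has
`√(a * b) = exp ((log a + log b) / 2)`, and `a β_0 b = 0` if `a = 0` or `b = 0`. -/
def scalarPowerMean (p a b : ℝ) : ℝ :=
  if p = 0 then Real.sqrt (a * b) else ((a ^ p + b ^ p) / 2) ^ (1 / p)

/-- A symmetric norm on `𝕄ₙ`: a norm (a definite seminorm) that is unitarily invariant. -/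
structure IsSymmetricNorm {n : ℕ} (ν : Seminorm ℂ (Matrix (Fin n) (Fin n) ℂ)) : Prop where
  definite : ∀ X, ν X = 0 → X = 0
  unitarily_invariant : ∀ X, ∀ U ∈ Matrix.unitaryGroup (Fin n) ℂ,
    ∀ V ∈ Matrix.unitaryGroup (Fin n) ℂ, ν (U * X * V) = ν X

/-- `N` is, on the positive semidefinite matrices, a derived anti-norm: for some symmetric norm `ν`
and some `r > 0`, `N A = ν (A ^ (-r)) ^ (-1 / r)` if `A` is invertible, and `N A = 0` otherwise.
The values of `N` off the positive semidefinite cone are irrelevant. -/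
def IsDerivedAntiNorm {n : ℕ} (N : Matrix (Fin n) (Fin n) ℂ → ℝ) : Prop :=
  ∃ ν : Seminorm ℂ (Matrix (Fin n) (Fin n) ℂ), IsSymmetricNorm ν ∧ ∃ r : ℝ, 0 < r ∧
    ∀ A : Matrix (Fin n) (Fin n) ℂ, A.PosSemidef →
      (IsUnit A → N A = ν (matrixRpow A (-r)) ^ (-1 / r)) ∧ (¬ IsUnit A → N A = 0)

end

/-! For `0 < p ≤ 1` put `F s = f (s ^ (1 / p))`, so that `f(A β_p B)` is `F` at the midpoint of `A ^
p` and `B ^ p`; for `p = 0` use `F = f ∘ exp` with `log A` and `log B`. The claim becomes a midpoint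
inequality for `F`.

Scalar part (`concaveOn_comp_rpow_rpow`): `F ^ p` is concave. At an interior point `z` of the
support of `f`, let `c = z f'(z+) / f(z)`. Concavity puts `f(t) / f(z)` below `1 + c (t/z - 1)`, and
geometric concavity puts it below `(t/z) ^ c`. Depending on `c`, one of the two gives the supporting
line `(f(t) / f(z)) ^ p ≤ 1 + c ((t/z) ^ p - 1)`. For `p = 0`, `log F` is concave where `F > 0`.

Matrix part (`IsSymmetricNorm.cfc_half_smul_add_le`): in an eigenbasis of the midpoint of two
Hermitian matrices, each eigenvalue is the mean of their diagonal entries. A bound `G ((x + y) / 2)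
≤ P x + Q y` with `P`, `Q` convex then passes to symmetric norms, by Jensen, monotonicity on
diagonals and pinching.

The two parts meet at `G = F ^ (-r)`, with `P`, `Q` multiples of `F ^ (-r)`, which is convex where
`F > 0`. The multipliers are tuned to the anti-norms of the two matrices, so that the bound is
exactly the power `-r` of the required mean. -/

/-! ### Symmetric norms: monotonicity on diagonals and pinching -/

theorem Matrix.diagonal_mem_unitaryGroup {n : ℕ} {w : Fin n → ℂ}
    (hw : ∀ i, w i * star (w i) = 1) :
    Matrix.diagonal w ∈ Matrix.unitaryGroup (Fin n) ℂ := by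
  rw [Matrix.mem_unitaryGroup_iff, Matrix.star_eq_conjTranspose, Matrix.diagonal_conjTranspose,
    Matrix.diagonal_mul_diagonal, ← Matrix.diagonal_one]
  congr 1
  funext i
  exact hw i

namespace IsSymmetricNorm

variable {n : ℕ} {ν : Seminorm ℂ (Matrix (Fin n) (Fin n) ℂ)}

theorem mul_left (hν : IsSymmetricNorm ν) (X : Matrix (Fin n) (Fin n) ℂ)
    {U : Matrix (Fin n) (Fin n) ℂ} (hU : U ∈ Matrix.unitaryGroup (Fin n) ℂ) :
    ν (U * X) = ν X := by
  simpa using hν.unitarily_invariant X U hU 1 (one_mem _)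

/-- Averaging two elements does not increase a seminorm beyond a common bound. -/
theorem half_add_le {X Y : Matrix (Fin n) (Fin n) ℂ} {c : ℝ} (hX : ν X ≤ c) (hY : ν Y ≤ c) :
    ν ((1 / 2 : ℂ) • (X + Y)) ≤ c := by
  rw [map_smul_eq_mul]
  have h := map_add_le_add ν X Y
  have : ‖(1 / 2 : ℂ)‖ = 1 / 2 := by simp
  rw [this]
  linarith

/-- A ratio `t = d / e` in `[0, 1]` is the real part of a unimodular number, so the smaller diagonal
is the average of two unitary multiples of the larger one. -/
theorem diagonal_mono (hν : IsSymmetricNorm ν) {d e : Fin n → ℝ} (h0 : ∀ i, 0 ≤ d i)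
    (h : ∀ i, d i ≤ e i) :
    ν (Matrix.diagonal fun i => (d i : ℂ)) ≤ ν (Matrix.diagonal fun i => (e i : ℂ)) := by
  set t : Fin n → ℝ := fun i => d i / e i with ht
  have ht0 : ∀ i, 0 ≤ t i := fun i => div_nonneg (h0 i) ((h0 i).trans (h i))
  have ht1 : ∀ i, t i ≤ 1 := fun i => div_le_one_of_le₀ (h i) ((h0 i).trans (h i))
  have hte : ∀ i, t i * e i = d i := by
    intro i
    by_cases he : e i = 0
    · have := h i
      have := h0 i
      rw [he, mul_zero]
      linarith
    · exact div_mul_cancel₀ _ he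
  have hs : ∀ i, Real.sqrt (1 - t i ^ 2) ^ 2 = 1 - t i ^ 2 := fun i =>
    Real.sq_sqrt (by nlinarith [ht0 i, ht1 i])
  set w : Fin n → ℂ := fun i => ⟨t i, Real.sqrt (1 - t i ^ 2)⟩ with hw
  have hw1 : ∀ i, w i * star (w i) = 1 := by
    intro i
    have := hs i
    rw [Complex.star_def, Complex.mul_conj, Complex.normSq_mk]
    norm_cast
    linarith
  have hw2 : ∀ i, star (w i) * star (star (w i)) = 1 := by
    intro i
    rw [star_star, mul_comm]
    exact hw1 i
  have key : (Matrix.diagonal fun i => (d i : ℂ)) = (1 / 2 : ℂ) •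
      (Matrix.diagonal w * (Matrix.diagonal fun i => (e i : ℂ)) +
        Matrix.diagonal (fun i => star (w i)) * (Matrix.diagonal fun i => (e i : ℂ))) := by
    rw [Matrix.diagonal_mul_diagonal, Matrix.diagonal_mul_diagonal, Matrix.diagonal_add,
      ← Matrix.diagonal_smul]
    congr 1
    funext i
    have h1 : w i + star (w i) = ((2 * t i : ℝ) : ℂ) := by
      rw [Complex.star_def, Complex.add_conj]
    rw [Pi.smul_apply, ← add_mul, h1, ← hte i]
    push_cast
    simp only [smul_eq_mul]
    ring
  rw [key]
  exact half_add_le (hν.mul_left _ (Matrix.diagonal_mem_unitaryGroup hw1)).le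
    (hν.mul_left _ (Matrix.diagonal_mem_unitaryGroup hw2)).le

/-- A symmetric norm does not increase under pinching to the diagonal. -/
theorem diagonal_diag_le (hν : IsSymmetricNorm ν) (X : Matrix (Fin n) (Fin n) ℂ) :
    ν (Matrix.diagonal fun i => X i i) ≤ ν X := by
  -- One index at a time: averaging with the conjugate by the diagonal matrix with `-1` at `k` and
  -- `1` elsewhere kills row and column `k` off the diagonal.
  have main : ∀ S : Finset (Fin n),
      ν (Matrix.of fun i j => if i = j ∨ (i ∉ S ∧ j ∉ S) then X i j else 0) ≤ ν X := by
    intro S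
    induction S using Finset.induction_on with
    | empty =>
      apply le_of_eq
      congr 1
      ext i j
      simp
    | insert k S _ ih =>
      set Y : Matrix (Fin n) (Fin n) ℂ :=
        Matrix.of fun i j => if i = j ∨ (i ∉ S ∧ j ∉ S) then X i j else 0 with hY
      set w : Fin n → ℂ := fun i => if i = k then -1 else 1 with hw
      have hD : Matrix.diagonal w ∈ Matrix.unitaryGroup (Fin n) ℂ := by
        apply Matrix.diagonal_mem_unitaryGroup
        intro i
        by_cases hi : i = k <;> simp [hw, hi]
      have key : (Matrix.of fun i j =>
          if i = j ∨ (i ∉ insert k S ∧ j ∉ insert k S) then X i j else 0) =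
          (1 / 2 : ℂ) • (Y + Matrix.diagonal w * Y * Matrix.diagonal w) := by
        ext i j
        simp only [hY, hw, Matrix.smul_apply, Matrix.add_apply, Matrix.mul_diagonal,
          Matrix.diagonal_mul, Matrix.of_apply, smul_eq_mul, Finset.mem_insert]
        by_cases hij : i = j
        · subst hij
          by_cases hi : i = k <;> simp [hi] <;> ring
        · by_cases hi : i = k <;> by_cases hj : j = k <;> by_cases h : i ∉ S ∧ j ∉ S <;>
            simp_all <;> ring
      rw [key]
      exact half_add_le ih ((hν.unitarily_invariant Y _ hD _ hD).le.trans ih)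
  have := main Finset.univ
  convert this using 2
  ext i j
  by_cases h : i = j <;> simp [Matrix.diagonal, h]

end IsSymmetricNorm

/-! ### Diagonal entries in an orthonormal basis and Jensen's inequality -/

namespace Matrix.IsHermitian

variable {n : ℕ} {A : Matrix (Fin n) (Fin n) ℂ}

/-- The weights do not depend on `P`. Comparing `P` with the identity gives Jensen, and `P = 1`
shows that they sum to one when `U` is unitary. -/
theorem conj_cfc_apply_diag (hA : A.IsHermitian) (U : Matrix (Fin n) (Fin n) ℂ) (P : ℝ → ℝ)
    (i : Fin n) :
    (star U * cfc P A * U) i i =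
      ((∑ j, Complex.normSq ((star U * (hA.eigenvectorUnitary : Matrix (Fin n) (Fin n) ℂ)) i j) *
        P (hA.eigenvalues j) : ℝ) : ℂ) := by
  set V : Matrix (Fin n) (Fin n) ℂ := (hA.eigenvectorUnitary : Matrix (Fin n) (Fin n) ℂ) with hV
  have h1 : star U * cfc P A * U =
      (star U * V) * Matrix.diagonal (fun j => (P (hA.eigenvalues j) : ℂ)) * star (star U * V) := by
    rw [hA.cfc_eq, Matrix.IsHermitian.cfc, Unitary.conjStarAlgAut_apply, star_mul, star_star]
    simp only [mul_assoc, hV]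
    rfl
  rw [h1, Matrix.mul_apply]
  push_cast
  refine Finset.sum_congr rfl fun j _ => ?_
  rw [Matrix.mul_diagonal, Matrix.star_apply, ← Complex.mul_conj, Complex.star_def]
  ring

theorem sum_normSq_conj (hA : A.IsHermitian) {U : Matrix (Fin n) (Fin n) ℂ}
    (hU : U ∈ Matrix.unitaryGroup (Fin n) ℂ) (i : Fin n) :
    ∑ j, Complex.normSq ((star U * (hA.eigenvectorUnitary : Matrix (Fin n) (Fin n) ℂ)) i j)
      = 1 := by
  have h := hA.conj_cfc_apply_diag U (fun _ => 1) i
  rw [cfc_const_one ℝ A hA.isSelfAdjoint, mul_one, Matrix.mem_unitaryGroup_iff'.mp hU, Matrix.one_apply_eq] at h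
  simp only [mul_one] at h
  exact_mod_cast h.symm

theorem conj_apply_diag_mem (hA : A.IsHermitian) {J : Set ℝ} (hJ : Convex ℝ J)
    (hAJ : spectrum ℝ A ⊆ J) {U : Matrix (Fin n) (Fin n) ℂ}
    (hU : U ∈ Matrix.unitaryGroup (Fin n) ℂ) (i : Fin n) :
    ((star U * A * U) i i).re ∈ J := by
  have h := hA.conj_cfc_apply_diag U id i
  rw [cfc_id ℝ A hA.isSelfAdjoint] at h
  rw [h, Complex.ofReal_re]
  exact hJ.sum_mem (fun j _ => Complex.normSq_nonneg _) (hA.sum_normSq_conj hU i)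
    fun j _ => hAJ (hA.eigenvalues_mem_spectrum_real j)

/-- Jensen's inequality for the diagonal of a Hermitian matrix in an orthonormal basis. -/
theorem convexOn_conj_apply_diag_le (hA : A.IsHermitian) {J : Set ℝ} {P : ℝ → ℝ}
    (hP : ConvexOn ℝ J P) (hAJ : spectrum ℝ A ⊆ J) {U : Matrix (Fin n) (Fin n) ℂ}
    (hU : U ∈ Matrix.unitaryGroup (Fin n) ℂ) (i : Fin n) :
    P ((star U * A * U) i i).re ≤ ((star U * cfc P A * U) i i).re := by
  have h := hA.conj_cfc_apply_diag U id i
  rw [cfc_id ℝ A hA.isSelfAdjoint] at h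
  rw [h, hA.conj_cfc_apply_diag U P i, Complex.ofReal_re, Complex.ofReal_re]
  exact hP.map_sum_le (fun j _ => Complex.normSq_nonneg _) (hA.sum_normSq_conj hU i)
    fun j _ => hAJ (hA.eigenvalues_mem_spectrum_real j)

theorem half_smul_add {B : Matrix (Fin n) (Fin n) ℂ} (hA : A.IsHermitian) (hB : B.IsHermitian) :
    ((1 / 2 : ℝ) • (A + B)).IsHermitian :=
  (IsSelfAdjoint.all (1 / 2 : ℝ)).smul (hA.add hB)

theorem eigenvalues_half_smul_add {B : Matrix (Fin n) (Fin n) ℂ} (hA : A.IsHermitian)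
    (hB : B.IsHermitian) (i : Fin n) :
    (hA.half_smul_add hB).eigenvalues i =
      (((star ((hA.half_smul_add hB).eigenvectorUnitary : Matrix (Fin n) (Fin n) ℂ) * A *
          ((hA.half_smul_add hB).eigenvectorUnitary : Matrix (Fin n) (Fin n) ℂ)) i i).re +
        ((star ((hA.half_smul_add hB).eigenvectorUnitary : Matrix (Fin n) (Fin n) ℂ) * B *
          ((hA.half_smul_add hB).eigenvectorUnitary : Matrix (Fin n) (Fin n) ℂ)) i i).re) / 2 := by
  set hC := hA.half_smul_add hB
  set W : Matrix (Fin n) (Fin n) ℂ := (hC.eigenvectorUnitary : Matrix (Fin n) (Fin n) ℂ)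
  have h1 := hC.conj_cfc_apply_diag W id i
  rw [cfc_id ℝ _ hC.isSelfAdjoint, Matrix.mem_unitaryGroup_iff'.mp hC.eigenvectorUnitary.2] at h1
  have h2 : (star W * ((1 / 2 : ℝ) • (A + B)) * W) i i =
      (1 / 2 : ℝ) • ((star W * A * W) i i + (star W * B * W) i i) := by
    rw [mul_smul_comm, smul_mul_assoc, mul_add, add_mul]
    rfl
  have h3 : (∑ j, Complex.normSq ((1 : Matrix (Fin n) (Fin n) ℂ) i j) * id (hC.eigenvalues j))
      = hC.eigenvalues i := by
    rw [Finset.sum_eq_single i]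
    · simp
    · intro j _ hj
      simp [Matrix.one_apply_ne hj.symm]
    · simp
  rw [h3, h2] at h1
  have h4 := congrArg Complex.re h1
  rw [Complex.ofReal_re, Complex.smul_re, Complex.add_re, smul_eq_mul] at h4
  linarith

theorem spectrum_half_smul_add_subset {B : Matrix (Fin n) (Fin n) ℂ} (hA : A.IsHermitian)
    (hB : B.IsHermitian) {J K S : Set ℝ} (hJ : Convex ℝ J) (hK : Convex ℝ K)
    (hAJ : spectrum ℝ A ⊆ J) (hBK : spectrum ℝ B ⊆ K)
    (hS : ∀ x ∈ J, ∀ y ∈ K, (x + y) / 2 ∈ S) :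
    spectrum ℝ ((1 / 2 : ℝ) • (A + B)) ⊆ S := by
  rw [(hA.half_smul_add hB).spectrum_real_eq_range_eigenvalues]
  rintro _ ⟨i, rfl⟩
  rw [hA.eigenvalues_half_smul_add hB]
  exact hS _ (hA.conj_apply_diag_mem hJ hAJ (hA.half_smul_add hB).eigenvectorUnitary.2 i)
    _ (hB.conj_apply_diag_mem hK hBK (hA.half_smul_add hB).eigenvectorUnitary.2 i)

end Matrix.IsHermitian

/-- Midpoint inequalities between scalar functions, with convex upper bounds, pass to symmetric
norms of matrices. -/
theorem IsSymmetricNorm.cfc_half_smul_add_le {n : ℕ}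
    {ν : Seminorm ℂ (Matrix (Fin n) (Fin n) ℂ)} (hν : IsSymmetricNorm ν)
    {A B : Matrix (Fin n) (Fin n) ℂ} (hA : A.IsHermitian) (hB : B.IsHermitian)
    {J K : Set ℝ} {G P Q : ℝ → ℝ} (hP : ConvexOn ℝ J P) (hQ : ConvexOn ℝ K Q)
    (hAJ : spectrum ℝ A ⊆ J) (hBK : spectrum ℝ B ⊆ K)
    (hG : ∀ x ∈ J, ∀ y ∈ K, 0 ≤ G ((x + y) / 2))
    (hGPQ : ∀ x ∈ J, ∀ y ∈ K, G ((x + y) / 2) ≤ P x + Q y) :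
    ν (cfc G ((1 / 2 : ℝ) • (A + B))) ≤ ν (cfc P A) + ν (cfc Q B) := by
  have hC := hA.half_smul_add hB
  set W : Matrix (Fin n) (Fin n) ℂ := (hC.eigenvectorUnitary : Matrix (Fin n) (Fin n) ℂ) with hWdef
  have hW : W ∈ Matrix.unitaryGroup (Fin n) ℂ := hC.eigenvectorUnitary.2
  have hW' : star W ∈ Matrix.unitaryGroup (Fin n) ℂ := Unitary.star_mem hW
  set M := cfc P A + cfc Q B with hM
  have hx := fun i => hA.conj_apply_diag_mem hP.1 hAJ hW i
  have hy := fun i => hB.conj_apply_diag_mem hQ.1 hBK hW i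
  have h1 : ν (cfc G ((1 / 2 : ℝ) • (A + B))) =
      ν (Matrix.diagonal fun i => (G (hC.eigenvalues i) : ℂ)) := by
    rw [hC.cfc_eq, Matrix.IsHermitian.cfc, Unitary.conjStarAlgAut_apply]
    exact hν.unitarily_invariant _ _ hW _ hW'
  have hreal : ∀ i, (((star W * M * W) i i).re : ℂ) = (star W * M * W) i i := by
    intro i
    have : (star W * M * W) i i = (star W * cfc P A * W) i i + (star W * cfc Q B * W) i i := by
      rw [hM, mul_add, add_mul]
      rfl
    rw [this, hA.conj_cfc_apply_diag, hB.conj_cfc_apply_diag, ← Complex.ofReal_add,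
      Complex.ofReal_re]
  -- Entrywise, `G` at an eigenvalue of the midpoint is at most `P` plus `Q` at the diagonal entries
  -- of `A` and `B`, hence at most the diagonal entry of `M` by Jensen.
  have h2 : ν (Matrix.diagonal fun i => (G (hC.eigenvalues i) : ℂ)) ≤
      ν (Matrix.diagonal fun i => (((star W * M * W) i i).re : ℂ)) := by
    apply hν.diagonal_mono
    · intro i
      rw [hA.eigenvalues_half_smul_add hB]
      exact hG _ (hx i) _ (hy i)
    · intro i
      rw [hA.eigenvalues_half_smul_add hB]
      refine (hGPQ _ (hx i) _ (hy i)).trans ?_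
      have e : ((star W * M * W) i i).re =
          ((star W * cfc P A * W) i i).re + ((star W * cfc Q B * W) i i).re := by
        rw [hM, mul_add, add_mul]
        rfl
      rw [e]
      exact add_le_add (hA.convexOn_conj_apply_diag_le hP hAJ hW i)
        (hB.convexOn_conj_apply_diag_le hQ hBK hW i)
  calc ν (cfc G ((1 / 2 : ℝ) • (A + B)))
      ≤ ν (Matrix.diagonal fun i => (((star W * M * W) i i).re : ℂ)) := h1.le.trans h2
    _ = ν (Matrix.diagonal fun i => (star W * M * W) i i) := by simp only [hreal]
    _ ≤ ν (star W * M * W) := hν.diagonal_diag_le _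
    _ = ν M := hν.unitarily_invariant _ _ hW' _ hW
    _ ≤ ν (cfc P A) + ν (cfc Q B) := map_add_le_add ν _ _

/-! ### Concave functions of one variable and power means -/

/-- A continuous midpoint concave function is concave. -/
theorem concaveOn_of_midpoint {J : Set ℝ} (hJ : Convex ℝ J) {L : ℝ → ℝ} (hc : ContinuousOn L J)
    (hm : ∀ x ∈ J, ∀ y ∈ J, (L x + L y) / 2 ≤ L ((x + y) / 2)) : ConcaveOn ℝ J L := by
  refine LinearOrder.concaveOn_of_lt hJ fun x hx y hy hxy a b ha hb hab => ?_
  simp only [smul_eq_mul]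
  set m := (L y - L x) / (y - x) with hmdef
  have hmy : m * (y - x) = L y - L x := div_mul_cancel₀ _ (by linarith)
  set h : ℝ → ℝ := fun t => L t - (L x + m * (t - x)) with hh
  have hsub : Set.Icc x y ⊆ J := hJ.ordConnected.out hx hy
  have hcont : ContinuousOn h (Set.Icc x y) := (hc.mono hsub).sub (by fun_prop)
  obtain ⟨t, ht, hmin⟩ := isCompact_Icc.exists_isMinOn (Set.nonempty_Icc.mpr hxy.le) hcont
  have hmid : ∀ u ∈ Set.Icc x y, ∀ v ∈ Set.Icc x y, (h u + h v) / 2 ≤ h ((u + v) / 2) := by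
    intro u hu v hv
    have := hm u (hsub hu) v (hsub hv)
    simp only [hh]
    linarith
  have hx0 : h x = 0 := by simp [hh]
  have hy0 : h y = 0 := by simp only [hh]; linarith
  -- Reflect the nearer endpoint in the minimiser `t`: since `h` vanishes at the endpoint, the
  -- midpoint inequality gives `h t ≥ h t / 2`.
  have ht0 : 0 ≤ h t := by
    rcases le_total t ((x + y) / 2) with h1 | h1
    · have hw : 2 * t - x ∈ Set.Icc x y := ⟨by linarith [ht.1], by linarith⟩
      have h2 := hmid x ⟨le_rfl, hxy.le⟩ _ hw
      have h3 : h t ≤ h (2 * t - x) := hmin hw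
      rw [show (x + (2 * t - x)) / 2 = t by ring] at h2
      linarith
    · have hw : 2 * t - y ∈ Set.Icc x y := ⟨by linarith, by linarith [ht.2]⟩
      have h2 := hmid y ⟨hxy.le, le_rfl⟩ _ hw
      have h3 : h t ≤ h (2 * t - y) := hmin hw
      rw [show (y + (2 * t - y)) / 2 = t by ring] at h2
      linarith
  have hz : a * x + b * y ∈ Set.Icc x y := by
    obtain rfl : a = 1 - b := by linarith
    constructor <;> nlinarith
  have h4 : 0 ≤ h (a * x + b * y) := ht0.trans (hmin hz)
  have h5 : a * L x + b * L y = L x + m * (a * x + b * y - x) := by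
    obtain rfl : a = 1 - b := by linarith
    linear_combination (-b) * hmy
  simp only [hh] at h4
  linarith

/-- The right derivative is a supergradient: it dominates slopes to the right of `z` and is at most
the left derivative, which is at most the slopes to the left. -/
theorem ConcaveOn.le_add_mul_of_hasDerivWithinAt_Ioi {S : Set ℝ} {f : ℝ → ℝ} {z d : ℝ}
    (hf : ConcaveOn ℝ S f) (hz : z ∈ interior S) (hd : HasDerivWithinAt f d (Set.Ioi z) z)
    {t : ℝ} (ht : t ∈ S) : f t ≤ f z + d * (t - z) := by
  have hzS := interior_subset hz
  rcases lt_trichotomy t z with h | rfl | h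
  · have h1 := hf.neg.leftDeriv_le_rightDeriv_of_mem_interior hz
    have h2 := hf.neg.slope_le_leftDeriv_of_mem_interior ht hz h
    rw [hd.neg.derivWithin (uniqueDiffWithinAt_Ioi z)] at h1
    have h3 := h2.trans h1
    rw [slope_def_field, div_le_iff₀ (by linarith)] at h3
    simp only [Pi.neg_apply] at h3
    linarith
  · simp
  · have h1 := hf.slope_le_of_hasDerivWithinAt_Ioi hzS ht h hd
    rw [slope_def_field, div_le_iff₀ (by linarith)] at h1
    linarith

/-- A non-negative function that is both concave and geometrically concave has, at each interior
point of its support, an affine and a power majorant with the same elasticity. -/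
theorem exists_affine_and_rpow_majorant {J : Set ℝ} {f : ℝ → ℝ} (hf : ConcaveOn ℝ J f)
    (hL : ConcaveOn ℝ {s | Real.exp s ∈ J ∧ 0 < f (Real.exp s)}
      fun s => Real.log (f (Real.exp s)))
    {z : ℝ} (hz : z ∈ interior {x ∈ J | 0 < f x}) (hz0 : 0 < z) :
    ∃ c : ℝ, (∀ t ∈ J, f t / f z ≤ 1 + c * (t / z - 1)) ∧
      ∀ t ∈ J, 0 < t → f t / f z ≤ (t / z) ^ c := by
  have hfz : 0 < f z := (interior_subset hz).2
  have hzJ : z ∈ interior J := interior_mono (Set.sep_subset _ _) hz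
  obtain ⟨d, hd⟩ : ∃ d, HasDerivWithinAt f d (Set.Ioi z) z := by
    have := (hf.neg.differentiableWithinAt_Ioi_of_mem_interior hzJ).neg
    rw [neg_neg] at this
    exact ⟨_, this.hasDerivWithinAt⟩
  -- The elasticity is also the right derivative of `log (f (exp s))` at `s = log z`.
  refine ⟨d * z / f z, fun t ht => ?_, fun t ht ht0 => ?_⟩
  · have := hf.le_add_mul_of_hasDerivWithinAt_Ioi hzJ hd ht
    rw [div_le_iff₀ hfz]
    refine this.trans (le_of_eq ?_)
    field_simp
  · rcases le_or_gt (f t) 0 with hft | hft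
    · exact (div_nonpos_of_nonpos_of_nonneg hft hfz.le).trans
        (Real.rpow_nonneg (div_nonneg ht0.le hz0.le) _)
    have hd' : HasDerivWithinAt (fun s => Real.log (f (Real.exp s))) (d * z / f z)
        (Set.Ioi (Real.log z)) (Real.log z) := by
      have h1 : HasDerivWithinAt Real.exp z (Set.Ioi (Real.log z)) (Real.log z) := by
        have := (Real.hasDerivAt_exp (Real.log z)).hasDerivWithinAt (s := Set.Ioi (Real.log z))
        rwa [Real.exp_log hz0] at this
      have h2 : HasDerivWithinAt f d (Set.Ioi z) (Real.exp (Real.log z)) := by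
        rwa [Real.exp_log hz0]
      have h3 : Set.MapsTo Real.exp (Set.Ioi (Real.log z)) (Set.Ioi z) := fun s hs =>
        (Real.log_lt_iff_lt_exp hz0).mp hs
      have h4 := (h2.comp _ h1 h3).log (by simpa [Real.exp_log hz0] using hfz.ne')
      simpa [Function.comp_def, Real.exp_log hz0] using h4
    have hint : Real.log z ∈ interior {s | Real.exp s ∈ J ∧ 0 < f (Real.exp s)} := by
      apply preimage_interior_subset_interior_preimage (t := {x ∈ J | 0 < f x})
        Real.continuous_exp
      rwa [Set.mem_preimage, Real.exp_log hz0]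
    have h5 := hL.le_add_mul_of_hasDerivWithinAt_Ioi hint hd' (t := Real.log t)
      (by rw [Set.mem_ofPred_eq, Real.exp_log ht0]; exact ⟨ht, hft⟩)
    rw [Real.exp_log ht0, Real.exp_log hz0, ← Real.log_div ht0.ne' hz0.ne'] at h5
    rw [← Real.log_le_log_iff (div_pos hft hfz) (Real.rpow_pos_of_pos (div_pos ht0 hz0) _),
      Real.log_rpow (div_pos ht0 hz0), Real.log_div hft.ne' hfz.ne']
    linarith

/-- Convexity of `x ^ q` with `v = 1 + c (u - 1)`: for `c ≤ 0` the point `1` is a convex combination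
of `v` and `u`; for `c ≥ 1` the point `u` is one of `v` and `1`. -/
theorem one_add_mul_rpow_sub_one_le {q c u : ℝ} (hq : 1 ≤ q) (hu : 0 ≤ u) (hc : c ≤ 0 ∨ 1 ≤ c)
    (hv : 0 ≤ 1 + c * (u - 1)) : 1 + c * (u ^ q - 1) ≤ (1 + c * (u - 1)) ^ q := by
  have hconv := (convexOn_rpow hq).2
  rcases hc with hc | hc
  · have hc' : 0 < 1 - c := by linarith
    have h := hconv (x := 1 + c * (u - 1)) hv (y := u) hu (a := 1 / (1 - c)) (b := -c / (1 - c))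
      (by positivity) (div_nonneg (by linarith) hc'.le) (by field_simp; ring)
    simp only [smul_eq_mul] at h
    rw [show 1 / (1 - c) * (1 + c * (u - 1)) + -c / (1 - c) * u = 1 by field_simp; ring,
      Real.one_rpow] at h
    have h2 := mul_le_mul_of_nonneg_left h hc'.le
    have h3 : (1 - c) * (1 / (1 - c) * (1 + c * (u - 1)) ^ q + -c / (1 - c) * u ^ q) =
        (1 + c * (u - 1)) ^ q - c * u ^ q := by field_simp; ring
    rw [h3] at h2
    linarith
  · have hc' : 0 < c := by linarith
    have h := hconv (x := 1 + c * (u - 1)) hv (y := 1) (by simp) (a := 1 / c) (b := (c - 1) / c)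
      (by positivity) (div_nonneg (by linarith) hc'.le) (by field_simp; ring)
    simp only [smul_eq_mul] at h
    rw [show 1 / c * (1 + c * (u - 1)) + (c - 1) / c * 1 = u by field_simp; ring,
      Real.one_rpow] at h
    have h2 := mul_le_mul_of_nonneg_left h hc'.le
    have h3 : c * (1 / c * (1 + c * (u - 1)) ^ q + (c - 1) / c * 1) =
        (1 + c * (u - 1)) ^ q + (c - 1) := by field_simp
    rw [h3] at h2
    linarith

/-- For `0 < c < 1` the power majorant suffices, by Bernoulli's inequality for `(τ ^ p) ^ c`.
Otherwise the affine majorant does, by convexity of `x ^ (1 / p)`. -/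
theorem rpow_le_one_add_mul_rpow_sub_one {p c F τ : ℝ} (hp : 0 < p) (hp1 : p ≤ 1) (hF : 0 ≤ F)
    (hτ : 0 ≤ τ) (h1 : F ≤ 1 + c * (τ - 1)) (h2 : 0 < τ → F ≤ τ ^ c)
    (h0 : τ = 0 → c ≤ 0 ∨ F = 0) :
    F ^ p ≤ 1 + c * (τ ^ p - 1) := by
  have hu : 0 ≤ τ ^ p := Real.rpow_nonneg hτ p
  have hq : 1 ≤ 1 / p := by rwa [le_div_iff₀ hp, one_mul]
  have hτu : (τ ^ p) ^ (1 / p) = τ := by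
    rw [← Real.rpow_mul hτ, mul_one_div_cancel hp.ne', Real.rpow_one]
  by_cases hc : c ≤ 0 ∨ 1 ≤ c
  · have hv : 0 ≤ 1 + c * (τ ^ p - 1) := by
      -- A negative right-hand side would force the affine majorant of `F` to be negative too,
      -- against `0 ≤ F`.
      by_contra! hv
      have h3 : c * τ ≤ c * τ ^ p := by
        rcases hc with hc | hc
        · have h4 : 1 ≤ τ ^ p := by nlinarith
          have h5 := Real.rpow_le_rpow_of_exponent_le h4 hq
          rw [Real.rpow_one, hτu] at h5
          nlinarith
        · have h4 : τ ^ p ≤ 1 := by nlinarith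
          have h5 := Real.rpow_le_rpow_of_exponent_ge_of_imp hu h4 hq fun _ h => by linarith
          rw [Real.rpow_one, hτu] at h5
          nlinarith
      linarith
    have h3 := one_add_mul_rpow_sub_one_le hq hu hc hv
    rw [hτu] at h3
    have h4 := Real.rpow_le_rpow hF (h1.trans h3) hp.le
    rwa [← Real.rpow_mul hv, one_div_mul_cancel hp.ne', Real.rpow_one] at h4
  · push Not at hc
    rcases hτ.eq_or_lt with hτ0 | hτ0
    · rcases h0 hτ0.symm with h | h
      · exact absurd h (by linarith)
      · rw [h, ← hτ0, Real.zero_rpow hp.ne']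
        linarith
    have h3 := Real.rpow_le_rpow hF (h2 hτ0) hp.le
    have h4 := rpow_one_add_le_one_add_mul_self (s := τ ^ p - 1) (by linarith) hc.1.le hc.2.le
    rw [add_sub_cancel, ← Real.rpow_mul hτ, mul_comm p c, Real.rpow_mul hτ] at h4
    exact h3.trans h4

theorem Convex.preimage_rpow_Ici {J : Set ℝ} (hJ : Convex ℝ J) {q : ℝ} (hq : 0 ≤ q) :
    Convex ℝ {s : ℝ | 0 ≤ s ∧ s ^ q ∈ J} := by
  apply Set.OrdConnected.convex
  refine ⟨fun x hx y hy t ht => ⟨hx.1.trans ht.1, hJ.ordConnected.out hx.2 hy.2 ⟨?_, ?_⟩⟩⟩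
  · exact Real.rpow_le_rpow hx.1 ht.1 hq
  · exact Real.rpow_le_rpow (hx.1.trans ht.1) ht.2 hq

/-- Concavity and geometric concavity together give concavity with respect to power means. -/
theorem concaveOn_comp_rpow_rpow {J : Set ℝ} {f : ℝ → ℝ} (hf : ConcaveOn ℝ J f)
    (hnn : ∀ x ∈ J, 0 ≤ f x)
    (hL : ConcaveOn ℝ {s | Real.exp s ∈ J ∧ 0 < f (Real.exp s)}
      fun s => Real.log (f (Real.exp s)))
    (h0 : 0 ∈ J → 0 < f 0 → ∀ t ∈ J, f t ≤ f 0) {p : ℝ} (hp : 0 < p) (hp1 : p ≤ 1) :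
    ConcaveOn ℝ {s | 0 ≤ s ∧ s ^ (1 / p) ∈ J} fun s => f (s ^ (1 / p)) ^ p := by
  have hip : 0 < 1 / p := one_div_pos.mpr hp
  have hconv := hf.1.preimage_rpow_Ici hip.le
  refine LinearOrder.concaveOn_of_lt hconv fun x hx y hy hxy a b ha hb hab => ?_
  simp only [smul_eq_mul]
  set w := a * x + b * y with hw
  have hxw : x < w := by
    obtain rfl : a = 1 - b := by linarith
    nlinarith
  have hwy : w < y := by
    obtain rfl : a = 1 - b := by linarith
    nlinarith
  have hw0 : 0 < w := lt_of_le_of_lt hx.1 hxw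
  set z := w ^ (1 / p) with hz
  have hz0 : 0 < z := Real.rpow_pos_of_pos hw0 _
  have hzIoo : z ∈ Set.Ioo (x ^ (1 / p)) (y ^ (1 / p)) :=
    ⟨Real.rpow_lt_rpow hx.1 hxw hip, Real.rpow_lt_rpow hw0.le hwy hip⟩
  have hsub : Set.Ioo (x ^ (1 / p)) (y ^ (1 / p)) ⊆ J :=
    Set.Ioo_subset_Icc_self.trans (hf.1.ordConnected.out hx.2 hy.2)
  by_cases hzero : f (x ^ (1 / p)) = 0 ∧ f (y ^ (1 / p)) = 0
  · rw [hzero.1, hzero.2, Real.zero_rpow hp.ne', mul_zero, mul_zero, add_zero]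
    exact Real.rpow_nonneg (hnn _ (hsub hzIoo)) _
  -- One endpoint value is now positive, so concavity makes `f` positive strictly between the
  -- endpoints.
  have hzi : z ∈ interior {t ∈ J | 0 < f t} := by
    suffices h : Set.Ioo (x ^ (1 / p)) (y ^ (1 / p)) ⊆ {t ∈ J | 0 < f t} from
      interior_maximal h isOpen_Ioo hzIoo
    intro t ht
    refine ⟨hsub ht, ?_⟩
    rw [← openSegment_eq_Ioo (ht.1.trans ht.2)] at ht
    obtain ⟨α, β, hα, hβ, hαβ, rfl⟩ := ht
    refine lt_of_lt_of_le ?_ (hf.2 hx.2 hy.2 hα.le hβ.le hαβ)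
    have hfx := hnn _ hx.2
    have hfy := hnn _ hy.2
    simp only [smul_eq_mul]
    rcases hfx.eq_or_lt with h | h
    · have h' : 0 < f (y ^ (1 / p)) := lt_of_le_of_ne hfy fun h' => hzero ⟨h.symm, h'.symm⟩
      have := mul_nonneg hα.le hfx
      have := mul_pos hβ h'
      linarith
    · have := mul_pos hα h
      have := mul_nonneg hβ.le hfy
      linarith
  have hfz : 0 < f z := (interior_subset hzi).2
  obtain ⟨c, hc1, hc2⟩ := exists_affine_and_rpow_majorant hf hL hzi hz0
  have hzp : z ^ p = w := by
    rw [hz, ← Real.rpow_mul hw0.le, one_div_mul_cancel hp.ne', Real.rpow_one]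
  -- A supporting line at `w`; averaging it at `x` and `y` with weights `a`, `b` gives concavity.
  have key : ∀ s, 0 ≤ s → s ^ (1 / p) ∈ J →
      f (s ^ (1 / p)) ^ p ≤ f z ^ p * (1 + c * (s / w - 1)) := by
    intro s hs hsJ
    have ht0 : 0 ≤ s ^ (1 / p) := Real.rpow_nonneg hs _
    have h := rpow_le_one_add_mul_rpow_sub_one (τ := s ^ (1 / p) / z) hp hp1
      (div_nonneg (hnn _ hsJ) hfz.le) (div_nonneg ht0 hz0.le) (hc1 _ hsJ)
      (fun h => hc2 _ hsJ (by
        rcases ht0.lt_or_eq with h' | h'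
        · exact h'
        · rw [← h'] at h
          simp at h))
      (fun h => by
        have h' : s ^ (1 / p) = 0 := by
          rcases div_eq_zero_iff.mp h with h | h
          · exact h
          · exact absurd h hz0.ne'
        rw [h'] at hsJ ⊢
        rcases (hnn 0 hsJ).eq_or_lt with hf0 | hf0
        · right
          rw [← hf0, zero_div]
        · left
          have h3 := hc1 0 hsJ
          have h4 := (one_le_div hfz).mpr (h0 hsJ hf0 z (hsub hzIoo))
          rw [zero_div] at h3
          linarith)
    rw [Real.div_rpow (hnn _ hsJ) hfz.le, Real.div_rpow ht0 hz0.le, ← Real.rpow_mul hs,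
      one_div_mul_cancel hp.ne', Real.rpow_one, hzp, div_le_iff₀ (Real.rpow_pos_of_pos hfz p)] at h
    linarith
  have hkx := mul_le_mul_of_nonneg_left (key x hx.1 hx.2) ha.le
  have hky := mul_le_mul_of_nonneg_left (key y hy.1 hy.2) hb.le
  have e : a * (f z ^ p * (1 + c * (x / w - 1))) + b * (f z ^ p * (1 + c * (y / w - 1))) =
      f z ^ p := by
    have e1 : a * (x / w) + b * (y / w) = 1 := by
      rw [← mul_div_assoc, ← mul_div_assoc, ← add_div, ← hw, div_self hw0.ne']
    linear_combination (f z ^ p * c) * e1 + (f z ^ p * (1 - c)) * hab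
  linarith

/-! ### Negative powers and doubly concave functions -/

theorem ConcaveOn.convexOn_exp_neg_mul {J : Set ℝ} {L : ℝ → ℝ} (hL : ConcaveOn ℝ J L) {r : ℝ}
    (hr : 0 ≤ r) : ConvexOn ℝ J fun s => Real.exp (-r * L s) := by
  have h : ConvexOn ℝ J fun s => -r * L s := by
    have := (hL.smul hr).neg
    refine this.congr fun s _ => ?_
    simp
  exact ⟨h.1, fun x hx y hy a b ha hb hab => (Real.exp_le_exp.mpr (h.2 hx hy ha hb hab)).trans
    (convexOn_exp.2 (Set.mem_univ _) (Set.mem_univ _) ha hb hab)⟩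

theorem ConcaveOn.convexOn_rpow_neg {J : Set ℝ} {φ : ℝ → ℝ} (hφ : ConcaveOn ℝ J φ)
    (hpos : ∀ s ∈ J, 0 < φ s) {q : ℝ} (hq : 0 ≤ q) : ConvexOn ℝ J fun s => φ s ^ (-q) := by
  have hlog : ConcaveOn ℝ J fun s => Real.log (φ s) := by
    refine ⟨hφ.1, fun x hx y hy a b ha hb hab => ?_⟩
    have h1 := strictConcaveOn_log_Ioi.concaveOn.2 (hpos x hx) (hpos y hy) ha hb hab
    have h2 : 0 < a • φ x + b • φ y :=
      (convex_Ioi (0 : ℝ)) (hpos x hx) (hpos y hy) ha hb hab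
    exact h1.trans (Real.log_le_log h2 (hφ.2 hx hy ha hb hab))
  refine (hlog.convexOn_exp_neg_mul hq).congr fun s hs => ?_
  simp only [Real.rpow_def_of_pos (hpos s hs), mul_comm (Real.log (φ s))]

namespace DoublyConcaveOn

variable {Ω : Set ℝ} {f : ℝ → ℝ}

theorem concaveOn_log_comp_exp (hf : DoublyConcaveOn Ω f) :
    ConcaveOn ℝ {s | Real.exp s ∈ Ω ∧ 0 < f (Real.exp s)} fun s => Real.log (f (Real.exp s)) := by
  have hJ : Convex ℝ {x ∈ Ω | 0 < f x} := hf.concaveOn.convex_gt 0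
  refine concaveOn_of_midpoint (hJ.ordConnected.preimage_mono Real.exp_monotone).convex ?_ ?_
  · refine ContinuousOn.log ?_ fun s hs => hs.2.ne'
    exact hf.continuousOn.comp Real.continuous_exp.continuousOn fun s hs => hs.1
  · intro x hx y hy
    have h1 := hf.geomConcave _ hx.1 _ hy.1
    have h2 : Real.sqrt (Real.exp x * Real.exp y) = Real.exp ((x + y) / 2) := by
      rw [← Real.exp_add, Real.exp_half]
    rw [h2] at h1
    have h3 := Real.log_le_log (Real.sqrt_pos.mpr (mul_pos hx.2 hy.2)) h1
    rwa [Real.log_sqrt (mul_pos hx.2 hy.2).le, Real.log_mul hx.2.ne' hy.2.ne'] at h3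

theorem concaveOn_rpow (hf : DoublyConcaveOn Ω f) {p : ℝ} (hp : 0 < p) (hp1 : p ≤ 1) :
    ConcaveOn ℝ {s | 0 ≤ s ∧ s ^ (1 / p) ∈ Ω} fun s => f (s ^ (1 / p)) ^ p := by
  refine concaveOn_comp_rpow_rpow hf.concaveOn hf.nonneg hf.concaveOn_log_comp_exp ?_ hp hp1
  intro h0 hpos t ht
  -- Geometric concavity against `0` reads `f 0 * f t ≤ f 0 ^ 2`, so `f 0` is maximal once it is
  -- positive.
  have h := hf.geomConcave 0 h0 t ht
  rw [zero_mul, Real.sqrt_zero, Real.sqrt_le_left hpos.le] at h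
  nlinarith

end DoublyConcaveOn

theorem Real.rpow_rpow_neg_div {x p : ℝ} (hx : 0 ≤ x) (hp : p ≠ 0) (r : ℝ) :
    (x ^ p) ^ (-(r / p)) = x ^ (-r) := by
  rw [← Real.rpow_mul hx]
  congr 1
  field_simp

theorem Convex.half_add_mem {K : Set ℝ} (hK : Convex ℝ K) {x y : ℝ} (hx : x ∈ K) (hy : y ∈ K) :
    (x + y) / 2 ∈ K := by
  have h : (1 / 2 : ℝ) • x + (1 / 2 : ℝ) • y ∈ K :=
    hK hx hy (by norm_num) (by norm_num) (by norm_num)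
  simp only [smul_eq_mul] at h
  rwa [show (x + y) / 2 = 1 / 2 * x + 1 / 2 * y by ring]

theorem ConcaveOn.half_add_le {K : Set ℝ} {g : ℝ → ℝ} (hg : ConcaveOn ℝ K g) {x y : ℝ}
    (hx : x ∈ K) (hy : y ∈ K) : (g x + g y) / 2 ≤ g ((x + y) / 2) := by
  have h : (1 / 2 : ℝ) • g x + (1 / 2 : ℝ) • g y ≤ g ((1 / 2 : ℝ) • x + (1 / 2 : ℝ) • y) :=
    hg.2 hx hy (by norm_num) (by norm_num) (by norm_num)
  simp only [smul_eq_mul] at h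
  rw [show 1 / 2 * x + 1 / 2 * y = (x + y) / 2 by ring] at h
  linarith

theorem setOf_rpow_pos_eq {K : Set ℝ} {F : ℝ → ℝ} (hF : ∀ s ∈ K, 0 ≤ F s) {p : ℝ} (hp : 0 < p) :
    {s ∈ K | 0 < F s ^ p} = {s ∈ K | 0 < F s} := by
  ext s
  refine and_congr_right fun hs => ⟨fun h => lt_of_le_of_ne (hF s hs) fun h0 => ?_,
    fun h => Real.rpow_pos_of_pos h p⟩
  rw [← h0, Real.zero_rpow hp.ne'] at h
  exact lt_irrefl _ h

theorem ConcaveOn.convexOn_rpow_neg_of_rpow {K : Set ℝ} {F : ℝ → ℝ} {p : ℝ} (hp : 0 < p)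
    (hF : ∀ s ∈ K, 0 ≤ F s) (hφ : ConcaveOn ℝ K fun s => F s ^ p) {r : ℝ} (hr : 0 ≤ r) :
    ConvexOn ℝ {s ∈ K | 0 < F s} fun s => F s ^ (-r) := by
  have hK : Convex ℝ {s ∈ K | 0 < F s} := by
    rw [← setOf_rpow_pos_eq hF hp]
    exact hφ.convex_gt 0
  refine ((hφ.subset (Set.sep_subset _ _) hK).convexOn_rpow_neg
    (fun s hs => Real.rpow_pos_of_pos hs.2 _) (div_nonneg hr hp.le)).congr fun s hs => ?_
  exact Real.rpow_rpow_neg_div hs.2.le hp.ne' r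

/-- Convexity of `s ^ (-q)` at `X / u` and `Y / v` with weights proportional to `u` and `v`.
Equality holds at `X = u`, `Y = v`, which makes the constants sharp enough for the power mean of
anti-norms. -/
theorem half_add_rpow_neg_le {u v X Y q : ℝ} (hu : 0 < u) (hv : 0 < v) (hX : 0 < X) (hY : 0 < Y)
    (hq : 0 ≤ q) :
    ((X + Y) / 2) ^ (-q) ≤ ((u + v) / 2) ^ (-q) * (u / (u + v)) * u ^ q * X ^ (-q) +
      ((u + v) / 2) ^ (-q) * (v / (u + v)) * v ^ q * Y ^ (-q) := by
  have hconv : ConvexOn ℝ (Set.Ioi (0 : ℝ)) fun s : ℝ => s ^ (-q) :=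
    (concaveOn_id (convex_Ioi 0)).convexOn_rpow_neg (fun s hs => hs) hq
  have huv : 0 < u + v := add_pos hu hv
  have hX' : X / u ∈ Set.Ioi (0 : ℝ) := div_pos hX hu
  have hY' : Y / v ∈ Set.Ioi (0 : ℝ) := div_pos hY hv
  have h := hconv.2 hX' hY' (div_pos hu huv).le (div_pos hv huv).le
    (by rw [← add_div, div_self huv.ne'])
  simp only [smul_eq_mul] at h
  have e : (X + Y) / 2 = (u + v) / 2 * (u / (u + v) * (X / u) + v / (u + v) * (Y / v)) := by
    field_simp
  rw [e, Real.mul_rpow (by positivity) (by positivity)]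
  refine (mul_le_mul_of_nonneg_left h (by positivity)).trans (le_of_eq ?_)
  have h1 : (X / u) ^ (-q) = u ^ q * X ^ (-q) := by
    rw [Real.div_rpow hX.le hu.le, Real.rpow_neg hu.le, div_inv_eq_mul, mul_comm]
  have h2 : (Y / v) ^ (-q) = v ^ q * Y ^ (-q) := by
    rw [Real.div_rpow hY.le hv.le, Real.rpow_neg hv.le, div_inv_eq_mul, mul_comm]
  rw [h1, h2]
  ring

theorem Seminorm.map_real_smul {E : Type*} [AddCommGroup E] [Module ℂ E] (ν : Seminorm ℂ E)
    {c : ℝ} (hc : 0 ≤ c) (X : E) : ν (c • X) = c * ν X := by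
  rw [← Complex.coe_smul, map_smul_eq_mul, Complex.norm_real, Real.norm_of_nonneg hc]

/-! ### Functional calculus on finite spectra -/

namespace Matrix

variable {n : ℕ} {A : Matrix (Fin n) (Fin n) ℂ}

theorem continuousOn_real_spectrum (A : Matrix (Fin n) (Fin n) ℂ) (g : ℝ → ℝ) :
    ContinuousOn g (spectrum ℝ A) :=
  A.finite_real_spectrum.continuousOn g

theorem continuousOn_image_real_spectrum (A : Matrix (Fin n) (Fin n) ℂ) (g h : ℝ → ℝ) :
    ContinuousOn g (h '' spectrum ℝ A) :=
  (A.finite_real_spectrum.image h).continuousOn g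

theorem IsHermitian.cfc_cfc (hA : A.IsHermitian) (g h : ℝ → ℝ) :
    cfc g (cfc h A) = cfc (fun s => g (h s)) A :=
  (cfc_comp' g h A (A.continuousOn_image_real_spectrum g h) (A.continuousOn_real_spectrum h)
    hA.isSelfAdjoint).symm

theorem isHermitian_cfc (A : Matrix (Fin n) (Fin n) ℂ) (g : ℝ → ℝ) : (cfc g A).IsHermitian :=
  cfc_predicate g A

theorem IsHermitian.spectrum_cfc (hA : A.IsHermitian) (g : ℝ → ℝ) :
    spectrum ℝ (cfc g A) = g '' spectrum ℝ A :=
  cfc_map_spectrum g A hA.isSelfAdjoint (A.continuousOn_real_spectrum g)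

theorem IsHermitian.posSemidef_cfc (hA : A.IsHermitian) {g : ℝ → ℝ}
    (hg : ∀ s ∈ spectrum ℝ A, 0 ≤ g s) : (cfc g A).PosSemidef := by
  rw [(isHermitian_cfc A g).posSemidef_iff_eigenvalues_nonneg]
  intro i
  have h := (isHermitian_cfc A g).eigenvalues_mem_spectrum_real i
  rw [hA.spectrum_cfc] at h
  obtain ⟨s, hs, h⟩ := h
  exact h ▸ hg s hs

theorem IsHermitian.isUnit_cfc (hA : A.IsHermitian) {g : ℝ → ℝ} :
    IsUnit (cfc g A) ↔ ∀ s ∈ spectrum ℝ A, g s ≠ 0 :=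
  isUnit_cfc_iff g A (A.continuousOn_real_spectrum g) hA.isSelfAdjoint

end Matrix

/-! ### Anti-norm inequalities at a midpoint -/

/-- `N` is the anti-norm on the positive semidefinite matrices derived from `ν` with exponent
`r`. -/
def IsAntiNormDerivedFrom {n : ℕ} (ν : Seminorm ℂ (Matrix (Fin n) (Fin n) ℂ)) (r : ℝ)
    (N : Matrix (Fin n) (Fin n) ℂ → ℝ) : Prop :=
  ∀ A : Matrix (Fin n) (Fin n) ℂ, A.PosSemidef →
    (IsUnit A → N A = ν (matrixRpow A (-r)) ^ (-1 / r)) ∧ (¬ IsUnit A → N A = 0)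

namespace IsAntiNormDerivedFrom

variable {n : ℕ} {ν : Seminorm ℂ (Matrix (Fin n) (Fin n) ℂ)} {r : ℝ}
  {N : Matrix (Fin n) (Fin n) ℂ → ℝ} {A B : Matrix (Fin n) (Fin n) ℂ} {F : ℝ → ℝ}

theorem nonneg (hN : IsAntiNormDerivedFrom ν r N) (hA : A.PosSemidef) : 0 ≤ N A := by
  by_cases h : IsUnit A
  · rw [(hN A hA).1 h]
    exact Real.rpow_nonneg (apply_nonneg ν _) _
  · rw [(hN A hA).2 h]

theorem cfc_nonneg (hN : IsAntiNormDerivedFrom ν r N) (hA : A.IsHermitian)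
    (hF : ∀ s ∈ spectrum ℝ A, 0 ≤ F s) : 0 ≤ N (cfc F A) :=
  hN.nonneg (hA.posSemidef_cfc hF)

theorem cfc_eq_zero (hN : IsAntiNormDerivedFrom ν r N) (hA : A.IsHermitian)
    (hF : ∀ s ∈ spectrum ℝ A, 0 ≤ F s) (h : ¬ ∀ s ∈ spectrum ℝ A, 0 < F s) :
    N (cfc F A) = 0 := by
  refine (hN _ (hA.posSemidef_cfc hF)).2 fun hu => h fun s hs => ?_
  exact lt_of_le_of_ne (hF s hs) (hA.isUnit_cfc.mp hu s hs).symm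

theorem cfc_eq_rpow (hN : IsAntiNormDerivedFrom ν r N) (hA : A.IsHermitian)
    (hF : ∀ s ∈ spectrum ℝ A, 0 < F s) :
    N (cfc F A) = ν (cfc (fun s => F s ^ (-r)) A) ^ (-1 / r) := by
  rw [(hN _ (hA.posSemidef_cfc fun s hs => (hF s hs).le)).1
    (hA.isUnit_cfc.mpr fun s hs => (hF s hs).ne'), matrixRpow, hA.cfc_cfc]

theorem seminorm_cfc_eq (hr : 0 < r) (hN : IsAntiNormDerivedFrom ν r N)
    (hA : A.IsHermitian) (hF : ∀ s ∈ spectrum ℝ A, 0 < F s) :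
    ν (cfc (fun s => F s ^ (-r)) A) = N (cfc F A) ^ (-r) := by
  rw [hN.cfc_eq_rpow hA hF, ← Real.rpow_mul (apply_nonneg ν _)]
  rw [show -1 / r * -r = 1 by field_simp, Real.rpow_one]

theorem seminorm_cfc_smul_eq (hr : 0 < r) (hN : IsAntiNormDerivedFrom ν r N)
    (hA : A.IsHermitian) (hF : ∀ s ∈ spectrum ℝ A, 0 < F s) {c : ℝ} (hc : 0 ≤ c) :
    ν (cfc (fun s => c • F s ^ (-r)) A) = c * N (cfc F A) ^ (-r) := by
  rw [cfc_smul c (fun s => F s ^ (-r)) A (A.continuousOn_real_spectrum _),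
    ν.map_real_smul hc, seminorm_cfc_eq hr hN hA hF]

theorem cfc_half_smul_add_nonneg (hN : IsAntiNormDerivedFrom ν r N) (hA : A.IsHermitian)
    (hB : B.IsHermitian) {K : Set ℝ} (hK : Convex ℝ K) (hF : ∀ s ∈ K, 0 ≤ F s)
    (hAK : spectrum ℝ A ⊆ K) (hBK : spectrum ℝ B ⊆ K) :
    0 ≤ N (cfc F ((1 / 2 : ℝ) • (A + B))) :=
  hN.cfc_nonneg (hA.half_smul_add hB) fun s hs => hF s <|
    hA.spectrum_half_smul_add_subset hB hK hK hAK hBK (fun _ hx _ hy => hK.half_add_mem hx hy) hs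

/-- The zero matrix is invertible here, so positivity on invertible matrices fails; the value is `0`
because `0 ^ (-1 / r) = 0` by convention. -/
theorem eq_zero_of_dim_zero {ν : Seminorm ℂ (Matrix (Fin 0) (Fin 0) ℂ)}
    {N : Matrix (Fin 0) (Fin 0) ℂ → ℝ} (hN : IsAntiNormDerivedFrom ν r N) (hr : 0 < r)
    (A : Matrix (Fin 0) (Fin 0) ℂ) : N A = 0 := by
  have hA : A = 0 := Subsingleton.elim _ _
  rw [(hN A (hA ▸ Matrix.PosSemidef.zero)).1 (isUnit_of_subsingleton A),
    Subsingleton.elim (matrixRpow A (-r)) 0, map_zero, Real.zero_rpow]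
  exact div_ne_zero (by norm_num) hr.ne'

variable [NeZero n]

theorem seminorm_cfc_pos (hν : IsSymmetricNorm ν) (hA : A.IsHermitian)
    (hF : ∀ s ∈ spectrum ℝ A, 0 < F s) : 0 < ν (cfc (fun s => F s ^ (-r)) A) := by
  refine lt_of_le_of_ne (apply_nonneg ν _) fun h => ?_
  have hu : IsUnit (cfc (fun s => F s ^ (-r)) A) :=
    hA.isUnit_cfc.mpr fun s hs => (Real.rpow_pos_of_pos (hF s hs) _).ne'
  rw [hν.definite _ h.symm] at hu
  exact not_isUnit_zero hu

theorem cfc_pos (hν : IsSymmetricNorm ν) (hN : IsAntiNormDerivedFrom ν r N) (hA : A.IsHermitian)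
    (hF : ∀ s ∈ spectrum ℝ A, 0 < F s) : 0 < N (cfc F A) := by
  rw [hN.cfc_eq_rpow hA hF]
  exact Real.rpow_pos_of_pos (seminorm_cfc_pos hν hA hF) _

theorem le_cfc (hν : IsSymmetricNorm ν) (hr : 0 < r) (hN : IsAntiNormDerivedFrom ν r N)
    (hA : A.IsHermitian) (hF : ∀ s ∈ spectrum ℝ A, 0 < F s) {k : ℝ} (hk : 0 < k)
    (h : ν (cfc (fun s => F s ^ (-r)) A) ≤ k ^ (-r)) : k ≤ N (cfc F A) := by
  rw [seminorm_cfc_eq hr hN hA hF] at h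
  exact (Real.rpow_le_rpow_iff_of_neg (cfc_pos hν hN hA hF) hk (neg_neg_of_pos hr)).mp h

/-- Midpoint inequalities for `F ^ (-r)` bound the derived anti-norm from below. -/
theorem le_cfc_half_smul_add (hν : IsSymmetricNorm ν) (hr : 0 < r)
    (hN : IsAntiNormDerivedFrom ν r N) (hA : A.IsHermitian) (hB : B.IsHermitian)
    {J K : Set ℝ} {P Q : ℝ → ℝ} (hAJ : spectrum ℝ A ⊆ J) (hBK : spectrum ℝ B ⊆ K)
    (hJ : ConvexOn ℝ J P) (hK : ConvexOn ℝ K Q)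
    (hpos : ∀ x ∈ J, ∀ y ∈ K, 0 < F ((x + y) / 2))
    (hPQ : ∀ x ∈ J, ∀ y ∈ K, F ((x + y) / 2) ^ (-r) ≤ P x + Q y) {k : ℝ}
    (hk : 0 < k) (h : ν (cfc P A) + ν (cfc Q B) ≤ k ^ (-r)) :
    k ≤ N (cfc F ((1 / 2 : ℝ) • (A + B))) := by
  refine le_cfc hν hr hN (hA.half_smul_add hB)
    (fun s hs => hA.spectrum_half_smul_add_subset hB (S := {s | 0 < F s}) hJ.1 hK.1 hAJ hBK
      hpos hs) hk ?_
  exact (hν.cfc_half_smul_add_le hA hB hJ hK hAJ hBK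
    (fun x hx y hy => (Real.rpow_pos_of_pos (hpos x hx y hy) _).le) hPQ).trans h

/-- A midpoint-type bound in which the first matrix may be singular after applying `F`. -/
theorem half_rpow_le_of_pos_right (hν : IsSymmetricNorm ν) (hr : 0 < r)
    (hN : IsAntiNormDerivedFrom ν r N) (hA : A.IsHermitian) (hB : B.IsHermitian)
    {K : Set ℝ} {p : ℝ} (hp : 0 < p) (hF : ∀ s ∈ K, 0 ≤ F s)
    (hφ : ConcaveOn ℝ K fun s => F s ^ p) (hAK : spectrum ℝ A ⊆ K) (hBK : spectrum ℝ B ⊆ K)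
    (hFB : ∀ s ∈ spectrum ℝ B, 0 < F s) :
    (N (cfc F B) ^ p / 2) ^ (1 / p) ≤ N (cfc F ((1 / 2 : ℝ) • (A + B))) := by
  have hb := cfc_pos hν hN hB hFB
  have hmid : ∀ x ∈ K, ∀ y ∈ {s ∈ K | 0 < F s}, F y ^ p / 2 ≤ F ((x + y) / 2) ^ p ∧
      0 < F ((x + y) / 2) := by
    intro x hx y hy
    have h1 := hφ.half_add_le hx hy.1
    have h2 := Real.rpow_nonneg (hF x hx) p
    have h3 := Real.rpow_pos_of_pos hy.2 p
    refine ⟨by linarith, lt_of_le_of_ne (hF _ (hφ.1.half_add_mem hx hy.1)) fun h => ?_⟩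
    rw [← h, Real.zero_rpow hp.ne'] at h1
    linarith
  have hconv := hφ.convexOn_rpow_neg_of_rpow hp hF hr.le
  have hBK' : spectrum ℝ B ⊆ {s ∈ K | 0 < F s} := fun s hs => ⟨hBK hs, hFB s hs⟩
  -- Dropping the term of `A` leaves `F y ^ p / 2`; its power `-(r / p)` is this constant times `F y
  -- ^ (-r)`.
  have hc : (0 : ℝ) ≤ (1 / 2) ^ (-(r / p)) := by positivity
  refine le_cfc_half_smul_add hν hr hN hA hB hAK
    hBK'
    (convexOn_const 0 hφ.1) (hconv.smul hc) (fun x hx y hy => (hmid x hx y hy).2)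
    (fun x hx y hy => ?_) (by positivity) ?_
  · obtain ⟨h1, h2⟩ := hmid x hx y hy
    rw [zero_add, ← Real.rpow_rpow_neg_div h2.le hp.ne', ← Real.rpow_rpow_neg_div hy.2.le hp.ne', smul_eq_mul,
      ← Real.mul_rpow (by norm_num) (Real.rpow_nonneg hy.2.le p)]
    have := Real.rpow_pos_of_pos hy.2 p
    exact Real.rpow_le_rpow_of_nonpos (by positivity) (by linarith)
      (neg_nonpos.mpr (div_pos hr hp).le)
  · rw [seminorm_cfc_smul_eq hr hN hB hFB hc, cfc_const_zero, map_zero, zero_add,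
      ← Real.rpow_mul (by positivity), show 1 / p * -r = -(r / p) by ring,
      ← Real.rpow_rpow_neg_div hb.le hp.ne', ← Real.mul_rpow (by norm_num) (by positivity)]
    exact le_of_eq (by congr 1; ring)

theorem half_add_rpow_le (hν : IsSymmetricNorm ν) (hr : 0 < r)
    (hN : IsAntiNormDerivedFrom ν r N) (hA : A.IsHermitian) (hB : B.IsHermitian)
    {K : Set ℝ} {p : ℝ} (hp : 0 < p) (hF : ∀ s ∈ K, 0 ≤ F s)
    (hφ : ConcaveOn ℝ K fun s => F s ^ p) (hAK : spectrum ℝ A ⊆ K) (hBK : spectrum ℝ B ⊆ K) :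
    ((N (cfc F A) ^ p + N (cfc F B) ^ p) / 2) ^ (1 / p) ≤
      N (cfc F ((1 / 2 : ℝ) • (A + B))) := by
  have hzero : ∀ M : Matrix (Fin n) (Fin n) ℂ, M.IsHermitian → spectrum ℝ M ⊆ K →
      (¬ ∀ s ∈ spectrum ℝ M, 0 < F s) → N (cfc F M) ^ p = 0 := fun M hM hMK h => by
    rw [hN.cfc_eq_zero hM (fun s hs => hF s (hMK hs)) h, Real.zero_rpow hp.ne']
  by_cases hFB : ∀ s ∈ spectrum ℝ B, 0 < F s
  swap
  · rw [hzero B hB hBK hFB, add_zero]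
    by_cases hFA : ∀ s ∈ spectrum ℝ A, 0 < F s
    · rw [add_comm A B]
      exact half_rpow_le_of_pos_right hν hr hN hB hA hp hF hφ hBK hAK hFA
    · rw [hzero A hA hAK hFA, zero_div, Real.zero_rpow (one_div_pos.mpr hp).ne']
      exact hN.cfc_half_smul_add_nonneg hA hB hφ.1 hF hAK hBK
  by_cases hFA : ∀ s ∈ spectrum ℝ A, 0 < F s
  swap
  · rw [hzero A hA hAK hFA, zero_add]
    exact half_rpow_le_of_pos_right hν hr hN hA hB hp hF hφ hAK hBK hFB
  have ha := cfc_pos hν hN hA hFA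
  have hb := cfc_pos hν hN hB hFB
  have hconv := hφ.convexOn_rpow_neg_of_rpow hp hF hr.le
  have hAK' : spectrum ℝ A ⊆ {s ∈ K | 0 < F s} := fun s hs => ⟨hAK hs, hFA s hs⟩
  have hBK' : spectrum ℝ B ⊆ {s ∈ K | 0 < F s} := fun s hs => ⟨hBK hs, hFB s hs⟩
  set u := N (cfc F A) ^ p with hu
  set v := N (cfc F B) ^ p with hv
  have hu0 : 0 < u := Real.rpow_pos_of_pos ha _
  have hv0 : 0 < v := Real.rpow_pos_of_pos hb _
  set q := r / p with hq
  have hq0 : 0 < q := div_pos hr hp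
  -- The factors `u ^ q`, `v ^ q` cancel the seminorms `u ^ (-q)`, `v ^ (-q)`, and the weights sum
  -- to one, leaving `((u + v) / 2) ^ (-q)`.
  have hα : 0 ≤ ((u + v) / 2) ^ (-q) * (u / (u + v)) * u ^ q := by positivity
  have hβ : 0 ≤ ((u + v) / 2) ^ (-q) * (v / (u + v)) * v ^ q := by positivity
  refine le_cfc_half_smul_add hν hr hN hA hB
    hAK' hBK'
    (hconv.smul hα) (hconv.smul hβ) (fun x hx y hy => (hconv.1.half_add_mem hx hy).2)
    (fun x hx y hy => ?_) (by positivity) ?_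
  · have h2 := (hconv.1.half_add_mem hx hy).2
    have hx2 := Real.rpow_pos_of_pos hx.2 p
    have hy2 := Real.rpow_pos_of_pos hy.2 p
    rw [smul_eq_mul, smul_eq_mul, ← Real.rpow_rpow_neg_div h2.le hp.ne',
      ← Real.rpow_rpow_neg_div hx.2.le hp.ne', ← Real.rpow_rpow_neg_div hy.2.le hp.ne']
    exact (Real.rpow_le_rpow_of_nonpos (by positivity) (hφ.half_add_le hx.1 hy.1)
      (neg_nonpos.mpr hq0.le)).trans (half_add_rpow_neg_le hu0 hv0 hx2 hy2 hq0.le)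
  · rw [seminorm_cfc_smul_eq hr hN hA hFA hα, seminorm_cfc_smul_eq hr hN hB hFB hβ,
      ← Real.rpow_rpow_neg_div ha.le hp.ne', ← Real.rpow_rpow_neg_div hb.le hp.ne', ← hu, ← hv,
      ← Real.rpow_mul (half_pos (add_pos hu0 hv0)).le, show 1 / p * -r = -q by rw [hq]; ring]
    have h1 : u ^ q * u ^ (-q) = 1 := by rw [← Real.rpow_add hu0, add_neg_cancel, Real.rpow_zero]
    have h2 : v ^ q * v ^ (-q) = 1 := by rw [← Real.rpow_add hv0, add_neg_cancel, Real.rpow_zero]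
    have h3 : u / (u + v) + v / (u + v) = 1 := by
      rw [← add_div, div_self (add_pos hu0 hv0).ne']
    rw [mul_assoc, h1, mul_assoc _ (v ^ q), h2, mul_one, mul_one, ← mul_add, h3, mul_one]

theorem sqrt_mul_le (hν : IsSymmetricNorm ν) (hr : 0 < r)
    (hN : IsAntiNormDerivedFrom ν r N) (hA : A.IsHermitian) (hB : B.IsHermitian)
    {K : Set ℝ} (hK : Convex ℝ K) (hF : ∀ s ∈ K, 0 ≤ F s)
    (hlog : ConcaveOn ℝ {s ∈ K | 0 < F s} fun s => Real.log (F s))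
    (hAK : spectrum ℝ A ⊆ K) (hBK : spectrum ℝ B ⊆ K) :
    Real.sqrt (N (cfc F A) * N (cfc F B)) ≤ N (cfc F ((1 / 2 : ℝ) • (A + B))) := by
  by_cases hFA : ∀ s ∈ spectrum ℝ A, 0 < F s
  swap
  · rw [hN.cfc_eq_zero hA (fun s hs => hF s (hAK hs)) hFA, zero_mul, Real.sqrt_zero]
    exact hN.cfc_half_smul_add_nonneg hA hB hK hF hAK hBK
  by_cases hFB : ∀ s ∈ spectrum ℝ B, 0 < F s
  swap
  · rw [hN.cfc_eq_zero hB (fun s hs => hF s (hBK hs)) hFB, mul_zero, Real.sqrt_zero]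
    exact hN.cfc_half_smul_add_nonneg hA hB hK hF hAK hBK
  have ha := cfc_pos hν hN hA hFA
  have hb := cfc_pos hν hN hB hFB
  have hAK' : spectrum ℝ A ⊆ {s ∈ K | 0 < F s} := fun s hs => ⟨hAK hs, hFA s hs⟩
  have hBK' : spectrum ℝ B ⊆ {s ∈ K | 0 < F s} := fun s hs => ⟨hBK hs, hFB s hs⟩
  set a := N (cfc F A) with ha'
  set b := N (cfc F B) with hb'
  have hconv : ConvexOn ℝ {s ∈ K | 0 < F s} fun s => F s ^ (-r) := by
    refine (hlog.convexOn_exp_neg_mul hr.le).congr fun s hs => ?_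
    simp only [Real.rpow_def_of_pos hs.2, mul_comm (Real.log (F s))]
  have hmid : ∀ x ∈ {s ∈ K | 0 < F s}, ∀ y ∈ {s ∈ K | 0 < F s},
      0 < F ((x + y) / 2) ∧
        F ((x + y) / 2) ^ (-r) ≤ F x ^ (-(r / 2)) * F y ^ (-(r / 2)) := by
    intro x hx y hy
    have h1 := hlog.half_add_le hx hy
    have h2 := hlog.1.half_add_mem hx hy
    refine ⟨h2.2, ?_⟩
    rw [Real.rpow_def_of_pos h2.2, Real.rpow_def_of_pos hx.2, Real.rpow_def_of_pos hy.2,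
      ← Real.exp_add]
    apply Real.exp_le_exp.mpr
    nlinarith
  -- Scaling for the arithmetic-geometric mean inequality: `s * t = 1`, and `s ^ 2 * a ^ (-r)` and
  -- `t ^ 2 * b ^ (-r)` both equal `√(a * b) ^ (-r)`.
  set s := (a / b) ^ (r / 4) with hs
  set t := (b / a) ^ (r / 4) with ht
  have hst : s * t = 1 := by
    rw [hs, ht, ← Real.mul_rpow (by positivity) (by positivity), div_mul_div_cancel₀ hb.ne',
      div_self ha.ne', Real.one_rpow]
  have hα : 0 ≤ s ^ 2 / 2 := by positivity
  have hβ : 0 ≤ t ^ 2 / 2 := by positivity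
  have hsq : ∀ x : ℝ, 0 < x → x ^ (-r) = (x ^ (-(r / 2))) ^ 2 := fun x hx => by
    rw [← Real.rpow_natCast, ← Real.rpow_mul hx.le]
    congr 1
    push_cast
    ring
  refine le_cfc_half_smul_add hν hr hN hA hB hAK'
    hBK' (hconv.smul hα) (hconv.smul hβ)
    (fun x hx y hy => (hmid x hx y hy).1) (fun x hx y hy => ?_) (by positivity) ?_
  · refine (hmid x hx y hy).2.trans ?_
    simp only [smul_eq_mul]
    rw [hsq _ hx.2, hsq _ hy.2]
    set g := F x ^ (-(r / 2))
    set h := F y ^ (-(r / 2))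
    have e : g * h = (s * g) * (t * h) := by
      linear_combination (-(g * h)) * hst
    nlinarith [sq_nonneg (s * g - t * h)]
  · rw [seminorm_cfc_smul_eq hr hN hA hFA hα, seminorm_cfc_smul_eq hr hN hB hFB hβ, ← ha', ← hb']
    have h1 : s ^ 2 * a ^ (-r) = Real.sqrt (a * b) ^ (-r) := by
      rw [hs, Real.sqrt_eq_rpow, ← Real.rpow_mul (by positivity), ← Real.rpow_natCast,
        ← Real.rpow_mul (by positivity), Real.div_rpow ha.le hb.le, Real.mul_rpow ha.le hb.le,
        div_eq_mul_inv, ← Real.rpow_neg hb.le, mul_right_comm, ← Real.rpow_add ha]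
      congr 2 <;> push_cast <;> ring
    have h2 : t ^ 2 * b ^ (-r) = Real.sqrt (a * b) ^ (-r) := by
      rw [ht, Real.sqrt_eq_rpow, ← Real.rpow_mul (by positivity), ← Real.rpow_natCast,
        ← Real.rpow_mul (by positivity), Real.div_rpow hb.le ha.le, Real.mul_rpow ha.le hb.le,
        div_eq_mul_inv, ← Real.rpow_neg ha.le, mul_right_comm, ← Real.rpow_add hb, mul_comm]
      congr 2 <;> push_cast <;> ring
    linarith

end IsAntiNormDerivedFrom

/-! ### The proposition, by change of variable -/

theorem proposition4p12 {n : ℕ} (Ω : Set ℝ) (f : ℝ → ℝ) (hf : DoublyConcaveOn Ω f)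
    (A B : Matrix (Fin n) (Fin n) ℂ)
    (hA : HermitianSpectrumIn Ω A) (hB : HermitianSpectrumIn Ω B)
    (N : Matrix (Fin n) (Fin n) ℂ → ℝ) (hN : IsDerivedAntiNorm N) :
    (∀ p : ℝ, 0 < p → p ≤ 1 →
      scalarPowerMean p (N (cfc f A)) (N (cfc f B)) ≤ N (cfc f (matrixPowerMean p A B))) ∧
    (IsUnit A → IsUnit B →
      scalarPowerMean 0 (N (cfc f A)) (N (cfc f B)) ≤ N (cfc f (matrixPowerMean 0 A B))) := by
  obtain ⟨ν, hν, r, hr, hN⟩ := hN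
  replace hN : IsAntiNormDerivedFrom ν r N := hN
  rcases Nat.eq_zero_or_pos n with rfl | hn
  · simp only [hN.eq_zero_of_dim_zero hr]
    refine ⟨fun p hp _ => ?_, fun _ _ => ?_⟩
    · simp [scalarPowerMean, hp.ne']
    · simp [scalarPowerMean]
  have : NeZero n := ⟨hn.ne'⟩
  obtain ⟨hA, hAΩ⟩ := hA
  obtain ⟨hB, hBΩ⟩ := hB
  refine ⟨fun p hp hp1 => ?_, fun hAu hBu => ?_⟩
  · have hspec : ∀ M : Matrix (Fin n) (Fin n) ℂ, M.IsHermitian → spectrum ℝ M ⊆ Ω →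
        cfc (fun s => f (s ^ (1 / p))) (matrixRpow M p) = cfc f M ∧
          spectrum ℝ (matrixRpow M p) ⊆ {s | 0 ≤ s ∧ s ^ (1 / p) ∈ Ω} := by
      intro M hM hMΩ
      have hinv : ∀ s ∈ spectrum ℝ M, (s ^ p) ^ (1 / p) = s := fun s hs => by
        rw [← Real.rpow_mul (hf.subset_Ici (hMΩ hs)), mul_one_div_cancel hp.ne', Real.rpow_one]
      constructor
      · rw [matrixRpow, hM.cfc_cfc]
        exact cfc_congr fun s hs => by simp only [hinv s hs]
      · rw [matrixRpow, hM.spectrum_cfc]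
        rintro _ ⟨s, hs, rfl⟩
        refine ⟨Real.rpow_nonneg (hf.subset_Ici (hMΩ hs)) _, ?_⟩
        simp only [hinv s hs]
        exact hMΩ hs
    have hA' : (matrixRpow A p).IsHermitian := Matrix.isHermitian_cfc _ _
    have hB' : (matrixRpow B p).IsHermitian := Matrix.isHermitian_cfc _ _
    have h := hN.half_add_rpow_le hν hr hA' hB' hp (F := fun s => f (s ^ (1 / p)))
      (fun s hs => hf.nonneg _ hs.2) (hf.concaveOn_rpow hp hp1) (hspec A hA hAΩ).2
      (hspec B hB hBΩ).2
    rw [(hspec A hA hAΩ).1, (hspec B hB hBΩ).1, ← (hA'.half_smul_add hB').cfc_cfc] at h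
    rwa [scalarPowerMean, if_neg hp.ne', matrixPowerMean, if_neg hp.ne', matrixRpow]
  · have hspec : ∀ M : Matrix (Fin n) (Fin n) ℂ, M.IsHermitian → spectrum ℝ M ⊆ Ω → IsUnit M →
        cfc (fun s => f (Real.exp s)) (cfc Real.log M) = cfc f M ∧
          spectrum ℝ (cfc Real.log M) ⊆ {s | Real.exp s ∈ Ω} := by
      intro M hM hMΩ hMu
      have hinv : ∀ s ∈ spectrum ℝ M, Real.exp (Real.log s) = s := fun s hs => by
        refine Real.exp_log (lt_of_le_of_ne (hf.subset_Ici (hMΩ hs)) fun h => ?_)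
        exact (spectrum.zero_notMem_iff ℝ).mpr hMu (h ▸ hs)
      constructor
      · rw [hM.cfc_cfc]
        exact cfc_congr fun s hs => by simp only [hinv s hs]
      · rw [hM.spectrum_cfc]
        rintro _ ⟨s, hs, rfl⟩
        rw [Set.mem_ofPred_eq, hinv s hs]
        exact hMΩ hs
    have hA' : (cfc Real.log A).IsHermitian := Matrix.isHermitian_cfc _ _
    have hB' : (cfc Real.log B).IsHermitian := Matrix.isHermitian_cfc _ _
    have h := hN.sqrt_mul_le hν hr hA' hB' (F := fun s => f (Real.exp s))
      (hf.ordConnected.preimage_mono Real.exp_monotone).convex (fun s hs => hf.nonneg _ hs)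
      hf.concaveOn_log_comp_exp (hspec A hA hAΩ hAu).2 (hspec B hB hBΩ hBu).2
    rw [(hspec A hA hAΩ hAu).1, (hspec B hB hBΩ hBu).1,
      ← (hA'.half_smul_add hB').cfc_cfc] at h
    rwa [scalarPowerMean, if_pos rfl, matrixPowerMean, if_pos rfl]
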